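/- **Lemma (Palm measure of the BLCP).** Let $n_{\rm B}\ge 1$, $R>0$, $\lambda>0$. For $(\theta,r)\in\mathcal D=[0,\pi)\times[-R,R]$ let $L_{(\theta,r)}=\{(x,y)\in\mathbb R^2: x\cos\theta+y\sin\theta=r\}$. A binomial line Cox process (BLCP) on $n$ lines is $\Phi=\bigcup_{i=1}^{n}\Phi_i$, where $L_1,\dots,L_n$ are the lines whose generating points are i.i.d. uniform on $\mathcal D$ and, given the lines, the $\Phi_i$ are independent one-dimensional Poisson point processes of intensity $\lambda$ on the lines $L_i$. Point processes are regarded as random locally finite sets, with the $\sigma$-algebra generated by the counts in Borel sets. Let $\Phi$ be a BLCP on $n_{\rm B}$ lines, with intensity measure $\Lambda(A)=\mathbb E\,\#(\Phi\cap A)$. The probability $\mathbb P(\Phi\in Y\mid {\bf x}\in\Phi)$ is understood as the Palm distribution of $\Phi$ at ${\bf x}$, i.e. as a probability kernel ${\bf x}\mapsto\mathbb P_{\bf x}$ such that $$\mathbb E\big[\#(\Phi\cap A)\,\mathbf 1\{\Phi\in Y\}\big]=\int_A \mathbb P_{\bf x}(Y)\,\Lambda(d{\bf x})\qquad\text{for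 all Borel } A\subseteq\mathbb R^2\text{ and all measurable } Y .$$ For ${\bf x}=(x_1,x_2)\in\mathbb R^2$ let $\Phi^!$ be a BLCP on $n_{\rm B}-1$ lines with the same $R$ and $\lambda$, and, independently of $\Phi^!$, let $\Phi_{\bf x}$ be a one-dimensional Poisson point process of intensity $\lambda$ on a random line through ${\bf x}$ whose normal direction $\theta$ is uniform on the set $\{\theta\in[0,\pi): |x_1\cos\theta+x_2\sin\theta|\le R\}$ of the directions of lines through ${\bf x}$ generated by a point of $\mathcal D$ (this is all of $[0,\pi)$ if $\|{\bf x}\|\le R$), the Poisson process being independent of the direction. Then $\Phi$ is a point process, $\Lambda$ is locally finite, and $$\mathbb P(\Phi\in Y\mid {\bf x}\in\Phi)=\mathbb P\big(\Phi^!\cup\Phi_{\bf x}\cup\{{\bf x}\}\in Y\big)\quad\text{for all measurable } Y,$$ in the following sense: the laws on the right-hand side, for ${\bf x}\in\mathbb R^2$, form a version of the Palm distributions of $\Phi$, and every other version agrees with it for $\Lambda$-almost every ${\bf x}$. -/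

import Mathlib

open MeasureTheory ProbabilityTheory Set
open scoped ENNReal NNReal

noncomputable section

/-- A point configuration: a locally finite subset of `E`, that is, a realization of a (simple)
point process. -/
@[ext]
structure PointConfig (E : Type*) [TopologicalSpace E] where
  carrier : Set E
  finite_inter_compact : ∀ K : Set E, IsCompact K → (carrier ∩ K).Finite

namespace PointConfig

variable {E F : Type*} [TopologicalSpace E] [TopologicalSpace F]

instance : Union (PointConfig E) where
  union φ ψ := ⟨φ.carrier ∪ ψ.carrier, fun K hK => by
    rw [union_inter_distrib_right]
    exact (φ.finite_inter_compact K hK).union (ψ.finite_inter_compact K hK)⟩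

instance : Singleton E (PointConfig E) where
  singleton x := ⟨{x}, fun _ _ => (finite_singleton x).subset inter_subset_left⟩

/-- The union of a finite family of configurations. -/
def iUnion {ι : Type*} [Finite ι] (φ : ι → PointConfig E) : PointConfig E where
  carrier := ⋃ i, (φ i).carrier
  finite_inter_compact K hK := by
    rw [iUnion_inter]
    exact finite_iUnion fun i => (φ i).finite_inter_compact K hK

/-- The image of a configuration under a closed embedding. -/
def image (f : E → F) (hf : Topology.IsClosedEmbedding f) (φ : PointConfig E) : PointConfig F where
  carrier := f '' φ.carrier
  finite_inter_compact K hK := by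
    rw [← image_inter_preimage]
    exact (φ.finite_inter_compact _ (hf.isCompact_preimage hK)).image f

variable [MeasurableSpace E]

/-- The counting measure of a configuration: for measurable `B`, `φ.countOn B` is the number of
points of `φ` in `B`. -/
def countOn (φ : PointConfig E) : Measure E := Measure.count.restrict φ.carrier

/-- The usual σ-algebra on configurations: the smallest one for which all the counts
`φ ↦ φ.countOn B`, `B` measurable, are measurable. -/
instance : MeasurableSpace (PointConfig E) := MeasurableSpace.comap countOn inferInstance

theorem measurable_countOn : Measurable (countOn : PointConfig E → Measure E) :=
  comap_measurable _

theorem countOn_apply (φ : PointConfig E) {B : Set E} (hB : MeasurableSet B) :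
    φ.countOn B = Measure.count (B ∩ φ.carrier) :=
  Measure.restrict_apply hB

/-- The intensity measure `B ↦ 𝔼 #(Φ ∩ B)` of a point process `Φ` with law `Q`. -/
def intensity (Q : Measure (PointConfig E)) : Measure E := Q.bind countOn

theorem intensity_apply (Q : Measure (PointConfig E)) {B : Set E} (hB : MeasurableSet B) :
    intensity Q B = ∫⁻ φ, φ.countOn B ∂Q :=
  Measure.bind_apply hB measurable_countOn.aemeasurable

/-- `κ` is a (regular) version of the Palm distributions of a point process `Φ` with law `Q`,
where `κ x Y` is the probability of `Φ ∈ Y` given that `Φ` has a point at `x`. It is the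
disintegration of the Campbell measure with respect to the intensity measure `Λ`:
`𝔼 [#(Φ ∩ A) ; Φ ∈ Y] = ∫_A κ x Y Λ(dx)` for all measurable `A` and `Y`. -/
structure IsPalmKernel (Q : Measure (PointConfig E)) (κ : Kernel E (PointConfig E)) : Prop where
  isMarkovKernel : IsMarkovKernel κ
  campbell : ∀ (A : Set E) (Y : Set (PointConfig E)), MeasurableSet A → MeasurableSet Y →
    ∫⁻ φ in Y, φ.countOn A ∂Q = ∫⁻ x in A, κ x Y ∂(intensity Q)

end PointConfig

/-- `T` is a homogeneous Poisson point process on `ℝ` with intensity `rate`, under `P`. -/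
structure IsPoissonProcess {Ω : Type*} [MeasurableSpace Ω] (P : Measure Ω) (rate : ℝ≥0)
    (T : Ω → PointConfig ℝ) : Prop where
  measurable : Measurable T
  hasLaw_count : ∀ B : Set ℝ, MeasurableSet B → volume B ≠ ∞ →
    HasLaw (fun ω => (T ω).countOn B)
      ((poissonMeasure (rate * (volume B).toNNReal)).map (Nat.cast : ℕ → ℝ≥0∞)) P
  iIndepFun_count : ∀ (m : ℕ) (B : Fin m → Set ℝ), (∀ i, MeasurableSet (B i)) →
    Pairwise (fun i j => Disjoint (B i) (B j)) →
    iIndepFun (fun (i : Fin m) ω => (T ω).countOn (B i)) P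

namespace BLCP

/-- The Euclidean plane. -/
abbrev Plane : Type := EuclideanSpace ℝ (Fin 2)

/-- The line `{(x, y) | x cos θ + y sin θ = r}` with generating point `(θ, r)`. -/
def line (g : ℝ × ℝ) : Set Plane :=
  {p | p 0 * Real.cos g.1 + p 1 * Real.sin g.1 = g.2}

/-- The arc length parametrization of the line with generating point `g = (θ, r)`, starting at the
foot of the perpendicular from the origin. -/
def lineParam (g : ℝ × ℝ) (s : ℝ) : Plane :=
  !₂[g.2 * Real.cos g.1 - s * Real.sin g.1, g.2 * Real.sin g.1 + s * Real.cos g.1]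

theorem isometry_lineParam (g : ℝ × ℝ) : Isometry (lineParam g) := by
  refine Isometry.of_dist_eq fun s t => ?_
  rw [EuclideanSpace.dist_eq, Real.dist_eq, ← Real.sqrt_sq_eq_abs]
  congr 1
  simp only [lineParam, Fin.sum_univ_two, Real.dist_eq, sq_abs, Matrix.cons_val_zero,
    Matrix.cons_val_one]
  linear_combination (s - t) ^ 2 * Real.sin_sq_add_cos_sq g.1

theorem range_lineParam (g : ℝ × ℝ) : range (lineParam g) = line g := by
  have h := Real.sin_sq_add_cos_sq g.1
  ext p
  simp only [line, mem_range, mem_ofPred_eq]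
  constructor
  · rintro ⟨s, rfl⟩
    simp only [lineParam, Matrix.cons_val_zero, Matrix.cons_val_one]
    linear_combination g.2 * h
  · intro hp
    refine ⟨p 1 * Real.cos g.1 - p 0 * Real.sin g.1, ?_⟩
    ext i
    fin_cases i
    · simp only [lineParam, ← hp, Fin.zero_eta, Matrix.cons_val_zero]
      linear_combination p 0 * h
    · simp only [lineParam, ← hp, Fin.mk_one, Matrix.cons_val_one, Matrix.cons_val_zero]
      linear_combination p 1 * h

/-- The configuration `T ⊆ ℝ` transported isometrically to the line with generating point `g`.
If `T` is a Poisson process on `ℝ` this is a 1D Poisson process on that line. -/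
def onLine (g : ℝ × ℝ) (T : PointConfig ℝ) : PointConfig Plane :=
  T.image (lineParam g) (isometry_lineParam g).isClosedEmbedding

/-- The domain set `[0, π) × [-R, R]` of generating points. -/
def domain (R : ℝ) : Set (ℝ × ℝ) := Ico 0 Real.pi ×ˢ Icc (-R) R

/-- `Φ` is a binomial line Cox process under `P`: almost surely the union of `n` mutually
independent Poisson processes of intensity `rate`, placed on the `n` lines whose generating points
`G i` are i.i.d. uniform on the domain set, independently of the Poisson processes. -/
def IsBLCP {Ω : Type*} [MeasurableSpace Ω] (P : Measure Ω) (n : ℕ) (R : ℝ) (rate : ℝ≥0)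
    (Φ : Ω → PointConfig Plane) : Prop :=
  ∃ (G : Fin n → Ω → ℝ × ℝ) (T : Fin n → Ω → PointConfig ℝ),
    (∀ i, pdf.IsUniform (G i) (domain R) P volume) ∧
    (∀ i, IsPoissonProcess P rate (T i)) ∧
    (∀ i, IndepFun (G i) (T i) P) ∧
    iIndepFun (fun i ω => (G i ω, T i ω)) P ∧
    ∀ᵐ ω ∂P, Φ ω = PointConfig.iUnion fun i => onLine (G i ω) (T i ω)

/-- The generating point of the line through `x` with normal direction `(cos θ, sin θ)`. -/
def throughPoint (x : Plane) (θ : ℝ) : ℝ × ℝ := (θ, x 0 * Real.cos θ + x 1 * Real.sin θ)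

theorem mem_line_throughPoint (x : Plane) (θ : ℝ) : x ∈ line (throughPoint x θ) := rfl

/-- The directions `θ` of the lines through `x` whose generating point is in the domain set. -/
def directions (R : ℝ) (x : Plane) : Set ℝ := {θ | throughPoint x θ ∈ domain R}

/-- Inside the disk of radius `R` every direction is available. -/
theorem directions_eq_of_norm_le {R : ℝ} {x : Plane} (hx : ‖x‖ ≤ R) :
    directions R x = Ico 0 Real.pi := by
  ext θ
  simp only [directions, throughPoint, domain, mem_ofPred_eq, mem_prod, and_iff_left_iff_imp]
  intro _
  have hR : 0 ≤ R := (norm_nonneg x).trans hx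
  have hn : x 0 ^ 2 + x 1 ^ 2 ≤ R ^ 2 := by
    have h := EuclideanSpace.real_norm_sq_eq x
    rw [Fin.sum_univ_two] at h
    nlinarith [norm_nonneg x]
  have h := Real.sin_sq_add_cos_sq θ
  refine abs_le.mp (abs_le_of_sq_le_sq ?_ hR)
  nlinarith [sq_nonneg (x 0 * Real.sin θ - x 1 * Real.cos θ)]

/-- `Ψ` is, under `P`, a 1D Poisson process of intensity `rate` on a random line through `x`, whose
direction is uniform among the available directions and independent of the Poisson process. -/
def IsPoissonOnLineThrough {Ω : Type*} [MeasurableSpace Ω] (P : Measure Ω) (R : ℝ) (rate : ℝ≥0)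
    (x : Plane) (Ψ : Ω → PointConfig Plane) : Prop :=
  ∃ (Θ : Ω → ℝ) (T : Ω → PointConfig ℝ),
    pdf.IsUniform Θ (directions R x) P volume ∧
    IsPoissonProcess P rate T ∧
    IndepFun Θ T P ∧
    ∀ᵐ ω ∂P, Ψ ω = onLine (throughPoint x (Θ ω)) (T ω)

end BLCP

end

/-! A configuration is a set, so its law is determined by its void probabilities (Rényi): the events
"no point in `B`", with `B` in a countable ring of relatively compact sets, form a π-system
generating the σ-algebra (`generateFrom_voidEvents`). The Campbell identity therefore need only be
checked on void events (`isPalmKernel_of_void`), where both sides can be computed.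

On a fixed line, a Poisson process that avoids `B` has its points of `A` in `A \ B`, and the counts
in `A \ B` and `B` are independent. This gives rate × length × void probability. To average over a
uniform line, fix the direction: distance and arc length are then orthonormal coordinates of the
plane, so choosing a line and then a point on it amounts to choosing a point `x` and then a
direction through it (`lintegral_domain_lineParam`).

The `n` line processes are i.i.d. without fixed points, hence a.s. disjoint, and counts of the union
add up. By independence each summand is the one-line Campbell integral times the void probability of
the other `n - 1` lines. The case `B = ∅` gives the intensity density `n * rate * |directions R x| /
|domain R|`. Dividing by it leaves, at `x ∉ B`, the void probability of `n - 1` lines times the mean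
void probability over uniform directions through `x`, which is the void probability of `Φ' ∪ Ψ x ∪
{x}`; at `x ∈ B` both are zero. Uniqueness follows because countably many void events suffice and
the intensity is σ-finite. -/

namespace PointConfig

/-! ### Void events and the σ-algebra of configurations -/

section General

variable {E : Type*} [TopologicalSpace E]

/-- The configurations without points in `B`. -/
def void (B : Set E) : Set (PointConfig E) := {φ | Disjoint φ.carrier B}

theorem mem_void {B : Set E} {φ : PointConfig E} : φ ∈ void B ↔ Disjoint φ.carrier B := Iff.rfl

theorem void_inter_void (B C : Set E) : void B ∩ void C = void (B ∪ C) := by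
  ext φ; simp [mem_void, disjoint_union_right]

theorem void_empty : void (∅ : Set E) = univ := by
  ext φ; simp [mem_void]

theorem carrier_union (φ ψ : PointConfig E) : (φ ∪ ψ).carrier = φ.carrier ∪ ψ.carrier := rfl

theorem carrier_singleton (x : E) : ({x} : PointConfig E).carrier = {x} := rfl

theorem carrier_iUnion {ι : Type*} [Finite ι] (φ : ι → PointConfig E) :
    (iUnion φ).carrier = ⋃ i, (φ i).carrier := rfl

theorem union_mem_void {φ ψ : PointConfig E} {B : Set E} :
    φ ∪ ψ ∈ void B ↔ φ ∈ void B ∧ ψ ∈ void B := by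
  simp [mem_void, carrier_union, disjoint_union_left]

theorem singleton_mem_void {x : E} {B : Set E} : ({x} : PointConfig E) ∈ void B ↔ x ∉ B := by
  simp [mem_void, carrier_singleton]

theorem iUnion_mem_void {ι : Type*} [Finite ι] {φ : ι → PointConfig E} {B : Set E} :
    iUnion φ ∈ void B ↔ ∀ i, φ i ∈ void B := by
  simp [mem_void, carrier_iUnion, disjoint_iUnion_left]

theorem countable_carrier [SigmaCompactSpace E] (φ : PointConfig E) : φ.carrier.Countable := by
  have : φ.carrier = ⋃ n, φ.carrier ∩ compactCovering E n := by
    rw [← inter_iUnion, iUnion_compactCovering, inter_univ]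
  rw [this]
  exact countable_iUnion fun n =>
    (φ.finite_inter_compact _ (isCompact_compactCovering E n)).countable

section TestAlgebra

variable [SigmaCompactSpace E] [SecondCountableTopology E]

variable (E) in
/-- A countable algebra generating the Borel sets. -/
def testAlgebra : Set (Set E) :=
  generateSetAlgebra (TopologicalSpace.countableBasis E ∪ range (compactCovering E))

variable (E) in
theorem isSetAlgebra_testAlgebra : IsSetAlgebra (testAlgebra E) := isSetAlgebra_generateSetAlgebra

variable (E) in
theorem countable_testAlgebra : (testAlgebra E).Countable :=
  countable_generateSetAlgebra
    ((TopologicalSpace.countable_countableBasis E).union (countable_range _))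

theorem compactCovering_mem_testAlgebra (n : ℕ) : compactCovering E n ∈ testAlgebra E :=
  self_subset_generateSetAlgebra (Or.inr ⟨n, rfl⟩)

variable (E) in
/-- A countable ring of relatively compact sets generating the Borel sets. -/
def testSets : Set (Set E) := {A | A ∈ testAlgebra E ∧ ∃ n, A ⊆ compactCovering E n}

variable (E) in
theorem countable_testSets : (testSets E).Countable :=
  (countable_testAlgebra E).mono fun _ h => h.1

theorem empty_mem_testSets : ∅ ∈ testSets E :=
  ⟨(isSetAlgebra_testAlgebra E).empty_mem, 0, empty_subset _⟩

theorem union_mem_testSets {A B : Set E} (hA : A ∈ testSets E) (hB : B ∈ testSets E) :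
    A ∪ B ∈ testSets E := by
  obtain ⟨hA, m, hm⟩ := hA
  obtain ⟨hB, n, hn⟩ := hB
  refine ⟨(isSetAlgebra_testAlgebra E).union_mem hA hB, max m n, union_subset ?_ ?_⟩
  · exact hm.trans (compactCovering_subset E (le_max_left _ _))
  · exact hn.trans (compactCovering_subset E (le_max_right _ _))

variable (E) in
/-- The void events of the sets in `testSets`. -/
def voidEvents : Set (Set (PointConfig E)) := void '' testSets E

variable (E) in
theorem countable_voidEvents : (voidEvents E).Countable := (countable_testSets E).image _

variable (E) in
theorem isPiSystem_voidEvents : IsPiSystem (voidEvents E) := by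
  rintro _ ⟨A, hA, rfl⟩ _ ⟨B, hB, rfl⟩ -
  exact ⟨A ∪ B, union_mem_testSets hA hB, (void_inter_void A B).symm⟩

variable [T2Space E]

theorem exists_testAlgebra_separating (F : Finset E) {x : E} (hx : x ∉ F) :
    ∃ A ∈ testAlgebra E, x ∉ A ∧ (F : Set E) ⊆ A := by
  classical
  induction F using Finset.induction_on with
  | empty => exact ⟨∅, (isSetAlgebra_testAlgebra E).empty_mem, by simp, by simp⟩
  | insert y F hy ih =>
    simp only [Finset.mem_insert, not_or] at hx
    obtain ⟨A, hA, hxA, hFA⟩ := ih hx.2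
    obtain ⟨U, hU, hyU, hUx⟩ := (TopologicalSpace.isBasis_countableBasis E).exists_subset_of_mem_open
      (show y ∈ ({x} : Set E)ᶜ from fun h => hx.1 h.symm) isOpen_compl_singleton
    refine ⟨U ∪ A, (isSetAlgebra_testAlgebra E).union_mem
      (self_subset_generateSetAlgebra (Or.inl hU)) hA, ?_, ?_⟩
    · rintro (h | h)
      · exact hUx h rfl
      · exact hxA h
    · rw [Finset.coe_insert, insert_subset_iff]
      exact ⟨Or.inl hyU, hFA.trans subset_union_right⟩

/-- Splitting one point off `m + 1` points by a set of the countable algebra: this turns a lower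
bound on a count into countably many conditions involving only a smaller bound and non-voidness. -/
theorem succ_le_encard_iff (S : Set E) (m : ℕ) :
    ((m + 1 : ℕ) : ℕ∞) ≤ S.encard ↔
      ∃ A ∈ testAlgebra E, (m : ℕ∞) ≤ (A ∩ S).encard ∧ (S ∩ Aᶜ).Nonempty := by
  classical
  constructor
  · intro h
    obtain ⟨T, hTS, hT⟩ := exists_subset_encard_eq h
    have hfin : T.Finite := finite_of_encard_eq_coe hT
    lift T to Finset E using hfin
    rw [encard_coe_eq_coe_finsetCard, Nat.cast_inj] at hT
    obtain ⟨x, hx⟩ : T.Nonempty := by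
      rw [← Finset.card_pos]; omega
    obtain ⟨A, hA, hxA, hFA⟩ := exists_testAlgebra_separating (T.erase x) (Finset.notMem_erase x T)
    refine ⟨A, hA, ?_, x, hTS hx, hxA⟩
    have h1 : ((T.erase x : Finset E) : Set E) ⊆ A ∩ S :=
      subset_inter hFA (fun y hy => hTS (Finset.mem_of_mem_erase hy))
    refine le_trans ?_ (encard_le_encard h1)
    rw [encard_coe_eq_coe_finsetCard, Finset.card_erase_of_mem hx, hT, Nat.add_sub_cancel]
  · rintro ⟨A, -, h1, h2⟩
    have h3 : (1 : ℕ∞) ≤ (S ∩ Aᶜ).encard := one_le_encard_iff_nonempty.mpr h2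
    have hd : Disjoint (A ∩ S) (S ∩ Aᶜ) :=
      disjoint_left.mpr fun y hy hy' => hy'.2 hy.1
    calc ((m + 1 : ℕ) : ℕ∞) = m + 1 := by push_cast; rfl
      _ ≤ (A ∩ S).encard + (S ∩ Aᶜ).encard := add_le_add h1 h3
      _ = ((A ∩ S) ∪ (S ∩ Aᶜ)).encard := (encard_union_eq hd).symm
      _ ≤ S.encard := encard_le_encard (union_subset inter_subset_right inter_subset_left)

end TestAlgebra

variable [MeasurableSpace E]

theorem measurable_countOn_apply {B : Set E} (hB : MeasurableSet B) :
    Measurable fun φ : PointConfig E => φ.countOn B :=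
  (Measure.measurable_coe hB).comp measurable_countOn

variable [T2Space E] [SigmaCompactSpace E] [BorelSpace E]

theorem measurableSet_carrier (φ : PointConfig E) : MeasurableSet φ.carrier :=
  φ.countable_carrier.measurableSet

theorem countOn_eq_encard (φ : PointConfig E) {B : Set E} (hB : MeasurableSet B) :
    φ.countOn B = (B ∩ φ.carrier).encard := by
  rw [countOn_apply φ hB, Measure.count_apply (hB.inter φ.measurableSet_carrier)]

theorem countOn_eq_zero_iff {φ : PointConfig E} {B : Set E} (hB : MeasurableSet B) :
    φ.countOn B = 0 ↔ φ ∈ void B := by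
  rw [countOn_eq_encard φ hB, mem_void, disjoint_iff_inter_eq_empty, inter_comm]
  simp

theorem countOn_lt_top (φ : PointConfig E) {K : Set E} (hK : IsCompact K) :
    φ.countOn K < ∞ := by
  rw [countOn_eq_encard φ hK.measurableSet, inter_comm]
  have := φ.finite_inter_compact K hK
  simpa using (encard_lt_top_iff.mpr this)

theorem measurableSet_void {B : Set E} (hB : MeasurableSet B) :
    MeasurableSet (void B : Set (PointConfig E)) := by
  have : (void B : Set (PointConfig E)) = (fun φ => φ.countOn B) ⁻¹' {0} := by
    ext φ; simp [countOn_eq_zero_iff hB]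
  rw [this]
  exact measurable_countOn_apply hB (measurableSet_singleton 0)

theorem countOn_iUnion_of_disjoint {ι : Type*} [Fintype ι] {φ : ι → PointConfig E}
    (h : Pairwise fun i j => Disjoint (φ i).carrier (φ j).carrier) {B : Set E}
    (hB : MeasurableSet B) : (iUnion φ).countOn B = ∑ i, (φ i).countOn B := by
  simp only [countOn, carrier_iUnion]
  rw [Measure.restrict_iUnion h fun i => (φ i).measurableSet_carrier, Measure.sum_apply _ hB,
    tsum_fintype]

variable [SecondCountableTopology E]

variable (E) in
theorem generateFrom_testAlgebra : ‹MeasurableSpace E› = MeasurableSpace.generateFrom (testAlgebra E) := by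
  rw [testAlgebra, generateFrom_generateSetAlgebra_eq]
  apply le_antisymm
  · rw [BorelSpace.measurable_eq (α := E),
      (TopologicalSpace.isBasis_countableBasis E).borel_eq_generateFrom]
    exact MeasurableSpace.generateFrom_mono subset_union_left
  · refine MeasurableSpace.generateFrom_le ?_
    rintro s (hs | ⟨n, rfl⟩)
    · exact (TopologicalSpace.isOpen_of_mem_countableBasis hs).measurableSet
    · exact (isCompact_compactCovering E n).measurableSet

theorem measurableSet_of_mem_testAlgebra {A : Set E} (hA : A ∈ testAlgebra E) :
    MeasurableSet A := by
  rw [generateFrom_testAlgebra E]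
  exact MeasurableSpace.measurableSet_generateFrom hA

theorem measurableSet_of_mem_testSets {A : Set E} (hA : A ∈ testSets E) : MeasurableSet A :=
  measurableSet_of_mem_testAlgebra hA.1

/-- Counting measures become finite after restriction to a compact set; there the π-λ argument
passes from the algebra to all Borel sets, and monotone limits remove the restriction. -/
theorem measurable_of_countOn_testAlgebra {X : Type*} [MeasurableSpace X] {f : X → PointConfig E}
    (hf : ∀ A ∈ testAlgebra E, Measurable fun x => (f x).countOn A) : Measurable f := by
  have key : ∀ n, ∀ B, MeasurableSet B →
      Measurable fun x => (f x).countOn (B ∩ compactCovering E n) := by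
    intro n B hB
    have hK : IsCompact (compactCovering E n) := isCompact_compactCovering E n
    have : ∀ x, IsFiniteMeasure ((f x).countOn.restrict (compactCovering E n)) := fun x =>
      ⟨by rw [Measure.restrict_apply_univ]; exact countOn_lt_top _ hK⟩
    have hmeas : Measurable fun x => (f x).countOn.restrict (compactCovering E n) := by
      refine Measurable.measure_of_isPiSystem (generateFrom_testAlgebra E)
        (fun s hs t ht _ => (isSetAlgebra_testAlgebra E).inter_mem hs ht) ?_ ?_
      · intro A hA
        simp_rw [Measure.restrict_apply (measurableSet_of_mem_testAlgebra hA)]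
        exact hf _ ((isSetAlgebra_testAlgebra E).inter_mem hA (compactCovering_mem_testAlgebra n))
      · simp_rw [Measure.restrict_apply_univ]
        exact hf _ (compactCovering_mem_testAlgebra n)
    simpa [Function.comp_def, Measure.restrict_apply hB] using
      (Measure.measurable_coe hB).comp hmeas
  rw [measurable_comap_iff]
  refine Measure.measurable_of_measurable_coe _ fun B hB => ?_
  have : (fun x => (countOn ∘ f) x B)
      = fun x => ⨆ n, (f x).countOn (B ∩ compactCovering E n) := by
    ext x
    have hmono : Monotone fun n => B ∩ compactCovering E n := fun m n h =>
      inter_subset_inter_right _ (compactCovering_subset E h)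
    rw [← hmono.measure_iUnion, ← inter_iUnion, iUnion_compactCovering, inter_univ]
    rfl
  rw [this]
  exact Measurable.iSup fun n => key n B hB

/-- Voidness on the ring gives voidness on the algebra by exhaustion. Induction on `m` through
`succ_le_encard_iff` then makes every event "at least `m` points in `A`" measurable. -/
theorem measurable_of_void {X : Type*} [MeasurableSpace X] {f : X → PointConfig E}
    (hf : ∀ A ∈ testSets E, MeasurableSet (f ⁻¹' void A)) : Measurable f := by
  have hf' : ∀ A ∈ testAlgebra E, MeasurableSet (f ⁻¹' void A) := by
    intro A hA
    have : f ⁻¹' void A = ⋂ n, f ⁻¹' void (A ∩ compactCovering E n) := by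
      rw [← preimage_iInter]
      congr 1
      ext φ
      simp only [mem_void, mem_iInter, ← disjoint_iUnion_right]
      rw [← inter_iUnion, iUnion_compactCovering, inter_univ]
    rw [this]
    exact MeasurableSet.iInter fun n => hf _ ⟨(isSetAlgebra_testAlgebra E).inter_mem hA
      (compactCovering_mem_testAlgebra n), n, inter_subset_right⟩
  have key : ∀ m : ℕ, ∀ A ∈ testAlgebra E,
      MeasurableSet {x | (m : ℕ∞) ≤ (A ∩ (f x).carrier).encard} := by
    intro m
    induction m with
    | zero => intro A _; simp
    | succ m ih =>
      intro A hA
      have : {x | ((m + 1 : ℕ) : ℕ∞) ≤ (A ∩ (f x).carrier).encard}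
          = ⋃ B ∈ testAlgebra E, {x | (m : ℕ∞) ≤ ((B ∩ A) ∩ (f x).carrier).encard}
            ∩ (f ⁻¹' void (A ∩ Bᶜ))ᶜ := by
        ext x
        simp only [mem_ofPred_eq, succ_le_encard_iff, mem_iUnion, mem_inter_iff, mem_compl_iff,
          mem_preimage, mem_void, exists_prop, inter_assoc, not_disjoint_iff_nonempty_inter]
        refine exists_congr fun B => and_congr_right fun _ => and_congr_right fun _ => ?_
        rw [inter_left_comm]
      rw [this]
      refine MeasurableSet.biUnion (countable_testAlgebra E) fun B hB => ?_
      exact (ih _ ((isSetAlgebra_testAlgebra E).inter_mem hB hA)).inter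
        (hf' _ ((isSetAlgebra_testAlgebra E).inter_mem hA
          ((isSetAlgebra_testAlgebra E).compl_mem hB))).compl
  refine measurable_of_countOn_testAlgebra fun A hA => ?_
  simp_rw [countOn_eq_encard _ (measurableSet_of_mem_testAlgebra hA)]
  -- A count is the supremum of the `m` that it dominates, hence a countable supremum of indicators
  -- of the events in `key`.
  have hsup : ∀ k : ℕ∞, (k : ℝ≥0∞)
      = ⨆ m : ℕ, {k : ℕ∞ | (m : ℕ∞) ≤ k}.indicator (fun _ => (m : ℝ≥0∞)) k := by
    intro k
    refine le_antisymm ?_ (iSup_le fun m => ?_)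
    · induction k using ENat.recTopCoe with
      | coe m => exact le_iSup_of_le m (by simp)
      | top => simp [ENNReal.iSup_natCast]
    · by_cases h : (m : ℕ∞) ≤ k
      · rw [indicator_of_mem (by exact h)]
        exact_mod_cast h
      · rw [indicator_of_notMem (by exact h)]
        exact zero_le
  simp_rw [hsup]
  exact Measurable.iSup fun m => measurable_const.indicator (key m A hA)

variable (E) in
theorem generateFrom_voidEvents :
    (inferInstance : MeasurableSpace (PointConfig E))
      = MeasurableSpace.generateFrom (voidEvents E) := by
  apply le_antisymm
  · have : @Measurable _ _ (MeasurableSpace.generateFrom (voidEvents E)) _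
        (id : PointConfig E → PointConfig E) := by
      refine @measurable_of_void E _ _ _ _ _ _ _ (MeasurableSpace.generateFrom (voidEvents E)) id
        fun A hA => ?_
      exact MeasurableSpace.measurableSet_generateFrom ⟨A, hA, rfl⟩
    intro s hs
    exact this hs
  · refine MeasurableSpace.generateFrom_le ?_
    rintro _ ⟨A, hA, rfl⟩
    exact measurableSet_void (measurableSet_of_mem_testSets hA)

/-- Rényi's theorem, from the generating π-system of void events; the void event of `∅` is
everything and matches the total masses. -/
theorem measure_ext_of_void {Q Q' : Measure (PointConfig E)} [IsFiniteMeasure Q]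
    (h : ∀ A ∈ testSets E, Q (void A) = Q' (void A)) : Q = Q' := by
  refine ext_of_generate_finite _ (generateFrom_voidEvents E) (isPiSystem_voidEvents E) ?_ ?_
  · rintro _ ⟨A, hA, rfl⟩
    exact h A hA
  · simpa [void_empty] using h ∅ empty_mem_testSets

theorem measurable_union :
    Measurable fun p : PointConfig E × PointConfig E => p.1 ∪ p.2 := by
  refine measurable_of_void fun A hA => ?_
  have hV := measurableSet_void (measurableSet_of_mem_testSets hA)
  have : (fun p : PointConfig E × PointConfig E => p.1 ∪ p.2) ⁻¹' void A
      = void A ×ˢ void A := by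
    ext p; simp [union_mem_void]
  rw [this]
  exact hV.prod hV

theorem measurable_iUnion {ι : Type*} [Finite ι] :
    Measurable fun φ : ι → PointConfig E => iUnion φ := by
  refine measurable_of_void fun A hA => ?_
  have hV := measurableSet_void (measurableSet_of_mem_testSets hA)
  have : (fun φ : ι → PointConfig E => iUnion φ) ⁻¹' void A
      = ⋂ i, (fun φ : ι → PointConfig E => φ i) ⁻¹' void A := by
    ext p; simp [iUnion_mem_void]
  rw [this]
  exact MeasurableSet.iInter fun i => measurable_pi_apply i hV

/-- Counts in a compact set are finite, so by inclusion–exclusion the count of the union equals the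
sum of the counts there exactly when no point is shared. -/
theorem measurableSet_disjoint :
    MeasurableSet {p : PointConfig E × PointConfig E | Disjoint p.1.carrier p.2.carrier} := by
  have : {p : PointConfig E × PointConfig E | Disjoint p.1.carrier p.2.carrier}
      = ⋂ n, {p | (p.1 ∪ p.2).countOn (compactCovering E n)
        = p.1.countOn (compactCovering E n) + p.2.countOn (compactCovering E n)} := by
    ext p
    have hset : p.1.carrier ∩ p.2.carrier
        = ⋃ n, compactCovering E n ∩ (p.1.carrier ∩ p.2.carrier) := by
      rw [← iUnion_inter, iUnion_compactCovering, univ_inter]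
    simp only [mem_iInter, mem_ofPred_eq]
    rw [disjoint_iff_inter_eq_empty, hset, iUnion_eq_empty]
    refine forall_congr' fun n => ?_
    have hK := isCompact_compactCovering E n
    have hfin := countOn_lt_top (p.1 ∪ p.2) hK
    simp only [countOn_eq_encard _ hK.measurableSet, carrier_union, inter_union_distrib_left]
      at hfin ⊢
    have h1 := encard_union_add_encard_inter (compactCovering E n ∩ p.1.carrier)
      (compactCovering E n ∩ p.2.carrier)
    rw [← inter_inter_distrib_left] at h1
    have h2 : (compactCovering E n ∩ p.1.carrier ∪ compactCovering E n ∩ p.2.carrier).encard ≠ ⊤ := by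
      intro h; rw [h] at hfin; simp at hfin
    rw [← encard_eq_zero]
    norm_cast
    rw [← h1]
    constructor
    · intro h; rw [h, add_zero]
    · intro h
      exact ((ENat.add_right_injective_of_ne_top h2) ((add_zero _).trans h)).symm
  rw [this]
  have hm := fun n : ℕ => measurable_countOn_apply (E := E)
    (isCompact_compactCovering E n).measurableSet
  exact MeasurableSet.iInter fun n => measurableSet_eq_fun ((hm n).comp measurable_union)
    (((hm n).comp measurable_fst).add ((hm n).comp measurable_snd))

end General

end PointConfig
-- Poisson processes on the real line
theorem lintegral_natCast_poissonMeasure (r : ℝ≥0) :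
    ∫⁻ k, (k : ℝ≥0∞) ∂poissonMeasure r = r := by
  -- The size-bias identity of the Poisson weights; summing it over `k` gives the mean.
  have hterm : ∀ k : ℕ, (((k + 1 : ℕ) : ℕ) : ℝ≥0∞) * poissonMeasure r {k + 1}
      = r * poissonMeasure r {k} := by
    intro k
    rw [poissonMeasure_singleton, poissonMeasure_singleton, ← ENNReal.ofReal_natCast,
      ← ENNReal.ofReal_coe_nnreal, ← ENNReal.ofReal_mul (by positivity),
      ← ENNReal.ofReal_mul (by positivity), Nat.factorial_succ]
    congr 1
    push_cast
    field_simp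
    ring
  rw [lintegral_countable', tsum_eq_zero_add' ENNReal.summable]
  simp only [hterm, Nat.cast_zero, zero_mul, zero_add, ENNReal.tsum_mul_left]
  have h1 : ∑' k : ℕ, poissonMeasure r {k} = 1 := by
    have := lintegral_countable' (μ := poissonMeasure r) fun _ => 1
    simpa using this.symm
  rw [h1, mul_one]

namespace IsPoissonProcess

open PointConfig

variable {Ω : Type*} [MeasurableSpace Ω] {P : Measure Ω} {rate : ℝ≥0} {T : Ω → PointConfig ℝ}

theorem measure_void (hT : IsPoissonProcess P rate T) {B : Set ℝ} (hB : MeasurableSet B)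
    (hfin : volume B ≠ ∞) :
    P.map T (void B) = ENNReal.ofReal (Real.exp (-(rate * (volume B).toNNReal : ℝ≥0))) := by
  have h := (hT.hasLaw_count B hB hfin).measure_eq (p := fun c => c = 0)
    (measurableSet_singleton 0)
  rw [Measure.map_apply .of_discrete
    (show MeasurableSet {x : ℝ≥0∞ | x = 0} from measurableSet_singleton 0)] at h
  have h0 : (Nat.cast : ℕ → ℝ≥0∞) ⁻¹' {x | x = 0} = {0} := by
    ext k; simp
  rw [h0, poissonMeasure_singleton] at h
  rw [Measure.map_apply hT.measurable (measurableSet_void hB)]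
  change P {ω | T ω ∈ void B} = _
  simpa [countOn_eq_zero_iff hB] using h

/-- The law of a Poisson process is determined by its rate. -/
theorem map_eq_map [IsFiniteMeasure P] (hT : IsPoissonProcess P rate T)
    {Ω' : Type*} [MeasurableSpace Ω'] {P' : Measure Ω'} {T' : Ω' → PointConfig ℝ}
    (hT' : IsPoissonProcess P' rate T') : P.map T = P'.map T' := by
  refine measure_ext_of_void fun A hA => ?_
  have hm := measurableSet_of_mem_testSets hA
  obtain ⟨-, n, hn⟩ := hA
  have hfin : volume A ≠ ∞ :=
    ((measure_mono hn).trans_lt (isCompact_compactCovering ℝ n).measure_lt_top).ne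
  rw [hT.measure_void hm hfin, hT'.measure_void hm hfin]

theorem lintegral_countOn_of_ne_top (hT : IsPoissonProcess P rate T) {A : Set ℝ}
    (hA : MeasurableSet A) (hfin : volume A ≠ ∞) :
    ∫⁻ ω, (T ω).countOn A ∂P = rate * volume A := by
  have h := (hT.hasLaw_count A hA hfin).lintegral_comp (f := id) aemeasurable_id
  simp only [id_eq] at h
  rw [h, lintegral_map measurable_id' .of_discrete, lintegral_natCast_poissonMeasure]
  push_cast
  rw [ENNReal.coe_toNNReal hfin]

theorem setLIntegral_void_countOn_of_ne_top (hT : IsPoissonProcess P rate T) {A B : Set ℝ}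
    (hA : MeasurableSet A) (hB : MeasurableSet B) (hAB : Disjoint A B) (hfin : volume A ≠ ∞) :
    ∫⁻ φ in void B, φ.countOn A ∂P.map T = rate * volume A * P.map T (void B) := by
  have hind : IndepFun (fun ω => (T ω).countOn A) (fun ω => (T ω).countOn B) P := by
    have h := (hT.iIndepFun_count 2 ![A, B] (by simp [Fin.forall_fin_two, hA, hB])
      (by
        intro i j hij
        fin_cases i <;> fin_cases j <;> simp_all [hAB.symm])).indepFun
      (show (0 : Fin 2) ≠ 1 by decide)
    simpa using h
  have hV := measurableSet_void hB
  have hcA := measurable_countOn_apply hA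
  have hcB := measurable_countOn_apply hB
  -- Composed with the count in `B`, the indicator of `{0}` is the indicator of the void event, so
  -- independence of the two counts factorises the integral.
  have hg : Measurable (({0} : Set ℝ≥0∞).indicator fun _ => (1 : ℝ≥0∞)) :=
    measurable_const.indicator (measurableSet_singleton 0)
  have hind' := hind.comp measurable_id hg
  have hmul := lintegral_mul_eq_lintegral_mul_lintegral_of_indepFun (hcA.comp hT.measurable)
    (hg.comp (hcB.comp hT.measurable)) hind'
  rw [← lintegral_indicator hV,
    lintegral_map (hcA.indicator hV) hT.measurable, Measure.map_apply hT.measurable hV,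
    ← hT.lintegral_countOn_of_ne_top hA hfin, ← lintegral_indicator_one (hT.measurable hV)]
  refine Eq.trans ?_ (hmul.trans ?_)
  · refine lintegral_congr fun ω => ?_
    by_cases h : T ω ∈ void B
    · simp [h, (countOn_eq_zero_iff hB).mpr h]
    · simp [h, mt (countOn_eq_zero_iff hB).mp h]
  · congr 1
    refine lintegral_congr fun ω => ?_
    by_cases h : T ω ∈ void B
    · simp [h, (countOn_eq_zero_iff hB).mpr h]
    · simp [h, mt (countOn_eq_zero_iff hB).mp h]

/-- The reduced Campbell formula of a Poisson process, on void events. -/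
theorem setLIntegral_void_countOn (hT : IsPoissonProcess P rate T) {A B : Set ℝ}
    (hA : MeasurableSet A) (hB : MeasurableSet B) (hAB : Disjoint A B) :
    ∫⁻ φ in void B, φ.countOn A ∂P.map T = rate * volume A * P.map T (void B) := by
  -- Poisson counts are prescribed only on sets of finite length; monotone convergence along compact
  -- truncations covers the rest.
  have hS : ∀ n, MeasurableSet (A ∩ compactCovering ℝ n) := fun n =>
    hA.inter (isCompact_compactCovering ℝ n).measurableSet
  have hmono : Monotone fun n => A ∩ compactCovering ℝ n := fun m n h =>
    inter_subset_inter_right _ (compactCovering_subset ℝ h)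
  have hsup : ∀ μ : Measure ℝ, μ A = ⨆ n, μ (A ∩ compactCovering ℝ n) := fun μ => by
    rw [← hmono.measure_iUnion, ← inter_iUnion, iUnion_compactCovering, inter_univ]
  simp_rw [hsup (countOn _)]
  rw [lintegral_iSup (fun n => measurable_countOn_apply (hS n))
    (fun m n h φ => measure_mono (hmono h)), hsup volume, ENNReal.mul_iSup, ENNReal.iSup_mul]
  refine iSup_congr fun n => ?_
  refine hT.setLIntegral_void_countOn_of_ne_top (hS n) hB (hAB.mono_left inter_subset_left) ?_
  exact ((measure_mono inter_subset_right).trans_lt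
    (isCompact_compactCovering ℝ n).measure_lt_top).ne

end IsPoissonProcess

/-! ### Joint measurability and transport to lines -/

namespace PointConfig

/-- The number of points of a configuration in a section of a measurable set is jointly
measurable. -/
theorem measurable_countOn_section {X E : Type*} [MeasurableSpace X] [TopologicalSpace E]
    [MeasurableSpace E] [T2Space E] [SigmaCompactSpace E] [BorelSpace E]
    {B : Set (X × E)} (hB : MeasurableSet B) :
    Measurable fun p : X × PointConfig E => p.2.countOn (Prod.mk p.1 ⁻¹' B) := by
  have hS : ∀ x, MeasurableSet (Prod.mk x ⁻¹' B) := fun x => measurable_prodMk_left hB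
  have key : ∀ n, Measurable fun p : X × PointConfig E =>
      p.2.countOn (Prod.mk p.1 ⁻¹' B ∩ compactCovering E n) := by
    intro n
    have hK := isCompact_compactCovering E n
    -- Truncation to a compact set gives a kernel of finite measures, for which section measures are
    -- jointly measurable.
    let κ : Kernel (X × PointConfig E) E :=
      { toFun := fun p => p.2.countOn.restrict (compactCovering E n)
        measurable' := by
          refine Measure.measurable_of_measurable_coe _ fun A hA => ?_
          simp_rw [Measure.restrict_apply hA]
          exact (measurable_countOn_apply (hA.inter hK.measurableSet)).comp measurable_snd }
    have hκ : ∀ p, κ p = p.2.countOn.restrict (compactCovering E n) := fun p => rfl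
    have hfin : ∀ p, IsFiniteMeasure (κ p) := fun p =>
      ⟨by rw [hκ, Measure.restrict_apply_univ]; exact countOn_lt_top _ hK⟩
    have hB' : MeasurableSet {q : (X × PointConfig E) × E | (q.1.1, q.2) ∈ B} :=
      ((measurable_fst.comp measurable_fst).prodMk measurable_snd) hB
    have h := Kernel.measurable_kernel_prodMk_left_of_finite hB' hfin
    convert! h using 2 with p
    rw [hκ]
    exact (Measure.restrict_apply (hS p.1)).symm
  have : (fun p : X × PointConfig E => p.2.countOn (Prod.mk p.1 ⁻¹' B))
      = fun p => ⨆ n, p.2.countOn (Prod.mk p.1 ⁻¹' B ∩ compactCovering E n) := by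
    ext p
    have hmono : Monotone fun n => Prod.mk p.1 ⁻¹' B ∩ compactCovering E n := fun m n h =>
      inter_subset_inter_right _ (compactCovering_subset E h)
    rw [← hmono.measure_iUnion, ← inter_iUnion, iUnion_compactCovering, inter_univ]
  rw [this]
  exact Measurable.iSup key

end PointConfig

namespace BLCP

open PointConfig

theorem continuous_lineParam : Continuous fun q : (ℝ × ℝ) × ℝ => lineParam q.1 q.2 := by
  unfold lineParam
  refine (PiLp.continuous_toLp 2 _).comp (continuous_pi fun i => ?_)
  fin_cases i
  · simp; fun_prop
  · simp; fun_prop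

theorem measurable_lineParam : Measurable fun q : (ℝ × ℝ) × ℝ => lineParam q.1 q.2 :=
  continuous_lineParam.measurable

theorem measurable_lineParam_right (g : ℝ × ℝ) : Measurable (lineParam g) :=
  measurable_lineParam.comp measurable_prodMk_left

theorem carrier_onLine (g : ℝ × ℝ) (T : PointConfig ℝ) :
    (onLine g T).carrier = lineParam g '' T.carrier := rfl

theorem onLine_mem_void {g : ℝ × ℝ} {T : PointConfig ℝ} {B : Set Plane} :
    onLine g T ∈ void B ↔ T ∈ void (lineParam g ⁻¹' B) := by
  rw [mem_void, mem_void, carrier_onLine, disjoint_image_left]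

theorem countOn_onLine (g : ℝ × ℝ) (T : PointConfig ℝ) {B : Set Plane} (hB : MeasurableSet B) :
    (onLine g T).countOn B = T.countOn (lineParam g ⁻¹' B) := by
  rw [countOn_eq_encard _ hB, countOn_eq_encard _ (measurable_lineParam_right g hB),
    carrier_onLine, inter_comm, ← image_inter_preimage,
    (isometry_lineParam g).injective.encard_image, inter_comm]

theorem measurable_onLine : Measurable fun p : (ℝ × ℝ) × PointConfig ℝ => onLine p.1 p.2 := by
  refine measurable_of_void fun A hA => ?_
  have hm := measurableSet_of_mem_testSets hA
  have h := measurable_countOn_section (measurable_lineParam hm) (measurableSet_singleton 0)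
  convert! h using 1
  ext p
  simp only [mem_preimage, mem_singleton_iff, onLine_mem_void]
  exact (countOn_eq_zero_iff (measurable_lineParam_right p.1 hm)).symm

end BLCP
-- Integral geometry of lines in the plane
namespace BLCP

open PointConfig

/-- The rotation of the plane by the angle `θ`. -/
noncomputable def rotation (θ : ℝ) : Plane →ₗᵢ[ℝ] Plane where
  toFun p := lineParam (θ, p 0) (p 1)
  map_add' p q := by
    ext i
    fin_cases i <;> simp [lineParam] <;> ring
  map_smul' c p := by
    ext i
    fin_cases i <;> simp [lineParam] <;> ring
  norm_map' p := by
    rw [EuclideanSpace.norm_eq, EuclideanSpace.norm_eq]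
    congr 1
    simp [lineParam, Fin.sum_univ_two]
    linear_combination (p 0 ^ 2 + p 1 ^ 2) * Real.sin_sq_add_cos_sq θ

theorem measurePreserving_rotation (θ : ℝ) : MeasurePreserving (rotation θ) volume volume :=
  ((rotation θ).toLinearIsometryEquiv rfl).measurePreserving

/-- For a fixed direction, `r` and `s` are the coordinates of the point in an orthonormal frame
rotated by `θ`. -/
theorem measurePreserving_lineParam (θ : ℝ) :
    MeasurePreserving (fun p : ℝ × ℝ => lineParam (θ, p.1) p.2) volume volume := by
  have h := (measurePreserving_rotation θ).comp ((PiLp.volume_preserving_toLp (Fin 2)).comp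
    (volume_preserving_finTwoArrow ℝ).symm)
  exact h

theorem throughPoint_lineParam (θ r s : ℝ) : throughPoint (lineParam (θ, r) s) θ = (θ, r) := by
  simp only [throughPoint, lineParam, Matrix.cons_val_zero, Matrix.cons_val_one, Prod.mk.injEq,
    true_and]
  linear_combination r * Real.sin_sq_add_cos_sq θ

theorem measurable_throughPoint : Measurable fun q : Plane × ℝ => throughPoint q.1 q.2 := by
  unfold throughPoint
  fun_prop

theorem measurableSet_domain (R : ℝ) : MeasurableSet (domain R) :=
  measurableSet_Ico.prod measurableSet_Icc

theorem measurableSet_directions (R : ℝ) (x : Plane) : MeasurableSet (directions R x) :=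
  (measurable_throughPoint.comp measurable_prodMk_left) (measurableSet_domain R)

theorem measurable_lintegral_directions (R : ℝ) {F : Plane × ℝ → ℝ≥0∞} (hF : Measurable F) :
    Measurable fun x => ∫⁻ θ in directions R x, F (x, θ) := by
  have hS : MeasurableSet {q : Plane × ℝ | q.2 ∈ directions R q.1} :=
    measurable_throughPoint (measurableSet_domain R)
  simp_rw [← lintegral_indicator (measurableSet_directions R _)]
  exact (hF.indicator hS).lintegral_prod_right'

theorem volume_domain (R : ℝ) :
    volume (domain R) = ENNReal.ofReal Real.pi * ENNReal.ofReal (2 * R) := by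
  rw [domain, Measure.volume_eq_prod, Measure.prod_prod, Real.volume_Ico, Real.volume_Icc]
  congr 2 <;> ring

theorem volume_domain_ne_zero {R : ℝ} (hR : 0 < R) : volume (domain R) ≠ 0 := by
  rw [volume_domain]
  simp [Real.pi_pos, hR]

theorem volume_domain_ne_top (R : ℝ) : volume (domain R) ≠ ∞ := by
  rw [volume_domain]
  exact ENNReal.mul_ne_top ENNReal.ofReal_ne_top ENNReal.ofReal_ne_top

theorem volume_directions_le (R : ℝ) (x : Plane) :
    volume (directions R x) ≤ ENNReal.ofReal Real.pi := by
  refine (measure_mono (t := Ico 0 Real.pi) fun θ hθ => hθ.1).trans ?_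
  rw [Real.volume_Ico, sub_zero]

theorem volume_directions_ne_top (R : ℝ) (x : Plane) : volume (directions R x) ≠ ∞ :=
  ((volume_directions_le R x).trans_lt ENNReal.ofReal_lt_top).ne

/-- Some line through `x` passes through the origin, since the signed distance changes sign between
`0` and `π`; by continuity nearby directions stay within distance `R`. -/
theorem volume_directions_ne_zero {R : ℝ} (hR : 0 < R) (x : Plane) :
    volume (directions R x) ≠ 0 := by
  set f : ℝ → ℝ := fun θ => x 0 * Real.cos θ + x 1 * Real.sin θ with hf
  have hcont : Continuous f := by fun_prop
  obtain ⟨θ₀, hθ₀, h0⟩ : ∃ θ ∈ Icc 0 Real.pi, f θ = 0 := by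
    rcases le_total 0 (x 0) with h | h
    · exact intermediate_value_Icc' Real.pi_pos.le hcont.continuousOn (by simp [hf, h])
    · exact intermediate_value_Icc Real.pi_pos.le hcont.continuousOn (by simp [hf, h])
  have hopen : IsOpen (f ⁻¹' Ioo (-R) R) := isOpen_Ioo.preimage hcont
  -- The zero may be an endpoint, but as a limit of interior angles it still has admissible interior
  -- angles nearby.
  rw [← closure_Ioo Real.pi_pos.ne] at hθ₀
  have hne : (f ⁻¹' Ioo (-R) R ∩ Ioo 0 Real.pi).Nonempty :=
    mem_closure_iff.mp hθ₀ _ hopen (by simp [h0, hR])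
  refine (((hopen.inter isOpen_Ioo).measure_pos volume hne).trans_le (measure_mono ?_)).ne'
  rintro θ ⟨h1, h2⟩
  exact ⟨⟨h2.1.le, h2.2⟩, h1.1.le, h1.2.le⟩

/-- Integration over the points of all lines: first choosing the line and then the point on it, or
first choosing the point and then the direction of the line. -/
theorem lintegral_domain_lineParam (R : ℝ) {F : (ℝ × ℝ) × Plane → ℝ≥0∞} (hF : Measurable F) :
    ∫⁻ g in domain R, ∫⁻ s, F (g, lineParam g s)
      = ∫⁻ x, ∫⁻ θ in directions R x, F (throughPoint x θ, x) := by
  -- With `F` cut off outside the domain set, both sides are integrals over full product spaces and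
  -- Tonelli applies directly.
  set F' : (ℝ × ℝ) × Plane → ℝ≥0∞ := (Prod.fst ⁻¹' domain R).indicator F with hF'
  have hmF' : Measurable F' := hF.indicator (measurable_fst (measurableSet_domain R))
  have hl : Measurable fun q : (ℝ × ℝ) × ℝ => F' (q.1, lineParam q.1 q.2) :=
    hmF'.comp (measurable_fst.prodMk measurable_lineParam)
  have ht : Measurable fun q : Plane × ℝ => F' (throughPoint q.1 q.2, q.1) :=
    hmF'.comp (measurable_throughPoint.prodMk measurable_fst)
  calc ∫⁻ g in domain R, ∫⁻ s, F (g, lineParam g s)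
      = ∫⁻ g, ∫⁻ s, F' (g, lineParam g s) := by
        rw [← lintegral_indicator (measurableSet_domain R)]
        refine lintegral_congr fun g => ?_
        by_cases hg : g ∈ domain R <;> simp [hF', hg, indicator]
    _ = ∫⁻ θ, ∫⁻ r, ∫⁻ s, F' ((θ, r), lineParam (θ, r) s) := by
        rw [Measure.volume_eq_prod, lintegral_prod _ hl.lintegral_prod_right'.aemeasurable]
    _ = ∫⁻ θ, ∫⁻ x, F' (throughPoint x θ, x) := by
        refine lintegral_congr fun θ => ?_
        have hθ : Measurable fun x => F' (throughPoint x θ, x) := ht.comp measurable_prodMk_right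
        rw [← (measurePreserving_lineParam θ).lintegral_comp hθ, Measure.volume_eq_prod,
          lintegral_prod (fun p : ℝ × ℝ => F' (throughPoint (lineParam (θ, p.1) p.2) θ,
            lineParam (θ, p.1) p.2))
            (hθ.comp (measurePreserving_lineParam θ).measurable).aemeasurable]
        simp only [throughPoint_lineParam]
    _ = ∫⁻ x, ∫⁻ θ, F' (throughPoint x θ, x) := by
        rw [lintegral_lintegral_swap]
        exact (ht.comp measurable_swap).aemeasurable
    _ = ∫⁻ x, ∫⁻ θ in directions R x, F (throughPoint x θ, x) := by
        refine lintegral_congr fun x => ?_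
        rw [← lintegral_indicator (measurableSet_directions R x)]
        refine lintegral_congr fun θ => ?_
        by_cases hg : throughPoint x θ ∈ domain R <;> simp [hF', hg, indicator, directions]

/-! ### The Campbell formula on one random line -/

/-- The law of a point process with law `τ` on `ℝ` transported to a random line with generating
point uniform on the domain set. -/
noncomputable def lineLaw (R : ℝ) (τ : Measure (PointConfig ℝ)) : Measure (PointConfig Plane) :=
  ((cond volume (domain R)).prod τ).map fun p => onLine p.1 p.2

variable {R : ℝ} {rate : ℝ≥0} {τ : Measure (PointConfig ℝ)}

theorem isProbabilityMeasure_cond_domain (hR : 0 < R) :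
    IsProbabilityMeasure (cond volume (domain R)) :=
  cond_isProbabilityMeasure_of_finite (volume_domain_ne_zero hR) (volume_domain_ne_top R)

theorem isProbabilityMeasure_lineLaw (hR : 0 < R) [IsProbabilityMeasure τ] :
    IsProbabilityMeasure (lineLaw R τ) := by
  have := isProbabilityMeasure_cond_domain hR
  exact Measure.isProbabilityMeasure_map measurable_onLine.aemeasurable

theorem measurable_void_lineParam [SFinite τ] {B : Set Plane} (hB : MeasurableSet B) :
    Measurable fun g => τ (void (lineParam g ⁻¹' B)) := by
  have h := measurable_measure_prodMk_left (ν := τ) (measurable_onLine (measurableSet_void hB))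
  convert! h using 3 with g
  ext T
  exact onLine_mem_void.symm

/-- The Campbell formula of a point process on a random line, on void events. -/
theorem setLIntegral_void_countOn_lineLaw (hR : 0 < R) [IsProbabilityMeasure τ]
    (hτ : ∀ A B : Set ℝ, MeasurableSet A → MeasurableSet B → Disjoint A B →
      ∫⁻ φ in void B, φ.countOn A ∂τ = rate * volume A * τ (void B))
    {A B : Set Plane} (hA : MeasurableSet A) (hB : MeasurableSet B) :
    ∫⁻ φ in void B, φ.countOn A ∂lineLaw R τ
      = ∫⁻ x in A, Bᶜ.indicator (fun x => (volume (domain R))⁻¹ * rate *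
        ∫⁻ θ in directions R x, τ (void (lineParam (throughPoint x θ) ⁻¹' B))) x := by
  have hV := measurableSet_void hB
  have hcA := measurable_countOn_apply hA
  have hh := measurable_void_lineParam (τ := τ) hB
  have hF : Measurable fun q : (ℝ × ℝ) × Plane =>
      (A \ B).indicator (fun _ => (rate : ℝ≥0∞)) q.2 * τ (void (lineParam q.1 ⁻¹' B)) :=
    ((measurable_const.indicator (hA.diff hB)).comp measurable_snd).mul (hh.comp measurable_fst)
  have hm : Measurable fun p : (ℝ × ℝ) × PointConfig ℝ =>
      (void B).indicator (fun φ : PointConfig Plane => φ.countOn A) (onLine p.1 p.2) :=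
    (hcA.indicator hV).comp measurable_onLine
  -- When `B` is avoided, the points in `A` are those in `A \ B`; this set is disjoint from `B`, as
  -- `hτ` requires.
  have hinner : ∀ g : ℝ × ℝ,
      ∫⁻ T, (void B).indicator (fun φ : PointConfig Plane => φ.countOn A) (onLine g T) ∂τ
        = ∫⁻ s, (A \ B).indicator (fun _ => (rate : ℝ≥0∞)) (lineParam g s)
          * τ (void (lineParam g ⁻¹' B)) := by
    intro g
    have hgm := measurable_lineParam_right g
    have hd : Disjoint (lineParam g ⁻¹' (A \ B)) (lineParam g ⁻¹' B) :=
      disjoint_sdiff_left.preimage _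
    rw [lintegral_mul_const' _ _ (measure_ne_top τ _)]
    have : ∫⁻ s, (A \ B).indicator (fun _ => (rate : ℝ≥0∞)) (lineParam g s)
        = rate * volume (lineParam g ⁻¹' (A \ B)) := by
      rw [← lintegral_indicator_const (hgm (hA.diff hB))]
      rfl
    rw [this, ← hτ _ _ (hgm (hA.diff hB)) (hgm hB) hd,
      ← lintegral_indicator (measurableSet_void (hgm hB))]
    refine lintegral_congr fun T => ?_
    by_cases hT : T ∈ void (lineParam g ⁻¹' B)
    · rw [indicator_of_mem (onLine_mem_void.mpr hT), indicator_of_mem hT, countOn_onLine _ _ hA,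
        countOn_eq_encard _ (hgm hA), countOn_eq_encard _ (hgm (hA.diff hB))]
      congr 2
      ext s
      simp only [mem_inter_iff, mem_preimage, mem_sdiff]
      exact ⟨fun h => ⟨⟨h.1, fun hs => disjoint_left.mp hT h.2 hs⟩, h.2⟩,
        fun h => ⟨h.1.1, h.2⟩⟩
    · rw [indicator_of_notMem (mt onLine_mem_void.mp hT), indicator_of_notMem hT]
  rw [← lintegral_indicator hV, lineLaw, lintegral_map (hcA.indicator hV) measurable_onLine,
    lintegral_prod _ hm.aemeasurable]
  simp only [hinner]
  rw [ProbabilityTheory.cond, lintegral_smul_measure, smul_eq_mul,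
    lintegral_domain_lineParam R hF, ← lintegral_const_mul']
  · rw [← lintegral_indicator hA]
    refine lintegral_congr fun x => ?_
    by_cases hxA : x ∈ A
    · by_cases hxB : x ∈ B
      · simp [hxA, hxB]
      · simp only []
        rw [indicator_of_mem (show x ∈ A \ B from ⟨hxA, hxB⟩), indicator_of_mem hxA,
          indicator_of_mem (show x ∈ Bᶜ from hxB), lintegral_const_mul' _ _ ENNReal.coe_ne_top,
          mul_assoc]
    · simp [hxA]
  · exact ENNReal.inv_ne_top.mpr (volume_domain_ne_zero hR)

end BLCP
-- Superposition of i.i.d. point processes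
namespace PointConfig

section Superposition

variable {E : Type*} [TopologicalSpace E] [MeasurableSpace E] [T2Space E] [SigmaCompactSpace E]
  [BorelSpace E] [SecondCountableTopology E]

/-- Two independent point processes have no common points if the second has no fixed points. -/
theorem ae_disjoint_prod {μ ν : Measure (PointConfig E)} [SFinite ν]
    (hν : ∀ x, intensity ν {x} = 0) :
    ∀ᵐ p ∂μ.prod ν, Disjoint p.1.carrier p.2.carrier := by
  refine (Measure.ae_prod_iff_ae_ae measurableSet_disjoint).mpr (ae_of_all _ fun φ => ?_)
  -- For frozen `φ`, its countable carrier is null for the intensity of `ν`, so `ψ` almost surely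
  -- misses it.
  have h0 : intensity ν φ.carrier = 0 := by
    rw [← biUnion_of_singleton φ.carrier, measure_biUnion_null_iff φ.countable_carrier]
    exact fun x _ => hν x
  rw [intensity_apply _ φ.measurableSet_carrier,
    lintegral_eq_zero_iff (measurable_countOn_apply φ.measurableSet_carrier)] at h0
  filter_upwards [h0] with ψ hψ
  exact ((countOn_eq_zero_iff φ.measurableSet_carrier).mp hψ).symm

variable {μ : Measure (PointConfig E)} [IsProbabilityMeasure μ]

theorem ae_pairwise_disjoint_pi {ι : Type*} [Fintype ι] (hμ : ∀ x, intensity μ {x} = 0) :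
    ∀ᵐ φ ∂Measure.pi fun _ : ι => μ,
      Pairwise fun i j => Disjoint (φ i).carrier (φ j).carrier := by
  have hind : iIndepFun (fun (i : ι) (φ : ι → PointConfig E) => φ i) (Measure.pi fun _ => μ) :=
    iIndepFun_pi (X := fun _ => id) fun _ => aemeasurable_id
  have hlaw : ∀ i : ι, HasLaw (fun φ : ι → PointConfig E => φ i) μ (Measure.pi fun _ => μ) :=
    fun i => (measurePreserving_eval (fun _ : ι => μ) i).hasLaw
  simp only [Pairwise, ae_all_iff]
  intro i j hij
  exact ((hind.indepFun hij).hasLaw_prod (hlaw i) (hlaw j)).ae_iff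
    (measurableSet_setOfPred.mp measurableSet_disjoint) |>.mpr (ae_disjoint_prod hμ)

theorem map_iUnion_pi_void {ι : Type*} [Fintype ι] {B : Set E} (hB : MeasurableSet B) :
    (Measure.pi fun _ : ι => μ).map iUnion (void B) = μ (void B) ^ Fintype.card ι := by
  rw [Measure.map_apply measurable_iUnion (measurableSet_void hB)]
  have : (iUnion : (ι → PointConfig E) → PointConfig E) ⁻¹' void B
      = pi univ fun _ => void B := by
    ext φ; simp [iUnion_mem_void]
  rw [this, Measure.pi_pi, Finset.prod_const, Finset.card_univ]

/-- The Campbell measure of a superposition of i.i.d. point processes, on void events. -/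
theorem setLIntegral_void_countOn_map_iUnion_pi {ι : Type*} [Fintype ι]
    (hμ : ∀ x, intensity μ {x} = 0) {A B : Set E} (hA : MeasurableSet A) (hB : MeasurableSet B) :
    ∫⁻ φ in void B, φ.countOn A ∂(Measure.pi fun _ : ι => μ).map iUnion
      = Fintype.card ι * μ (void B) ^ (Fintype.card ι - 1) * ∫⁻ φ in void B, φ.countOn A ∂μ := by
  classical
  have hV := measurableSet_void hB
  have hcA := measurable_countOn_apply hA
  -- The product over `j` of `X i j` counts the points of component `i` in `A` while all components
  -- avoid `B`; each factor depends on a single component, so the integral factorises.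
  let X : ι → ι → PointConfig E → ℝ≥0∞ := fun i j =>
    if j = i then (void B).indicator fun φ => φ.countOn A else (void B).indicator 1
  have hX : ∀ i j, Measurable (X i j) := fun i j => by
    by_cases h : j = i
    · simpa [X, h] using hcA.indicator hV
    · simpa [X, h] using measurable_one.indicator hV
  have hind : iIndepFun (fun (i : ι) (φ : ι → PointConfig E) => φ i) (Measure.pi fun _ => μ) :=
    iIndepFun_pi (X := fun _ => id) fun _ => aemeasurable_id
  have hprod : ∀ i, ∫⁻ φ : ι → PointConfig E, ∏ j, X i j (φ j) ∂Measure.pi (fun _ => μ)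
      = μ (void B) ^ (Fintype.card ι - 1) * ∫⁻ φ in void B, φ.countOn A ∂μ := by
    intro i
    rw [lintegral_prod_eq_prod_lintegral_of_indepFun Finset.univ
      (fun j (φ : ι → PointConfig E) => X i j (φ j))
      (hind.comp (X i) (hX i)) (fun j => (hX i j).comp (measurable_pi_apply j))]
    have h1 : ∀ j, ∫⁻ φ : ι → PointConfig E, X i j (φ j) ∂Measure.pi (fun _ => μ)
        = ∫⁻ φ, X i j φ ∂μ := fun j =>
      (measurePreserving_eval (fun _ : ι => μ) j).lintegral_comp (hX i j)
    simp only [h1]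
    rw [← Finset.prod_erase_mul _ _ (Finset.mem_univ i)]
    congr 1
    · rw [Finset.prod_congr rfl (g := fun _ => μ (void B)), Finset.prod_const,
        Finset.card_erase_of_mem (Finset.mem_univ i), Finset.card_univ]
      intro j hj
      simp only [X, if_neg (Finset.ne_of_mem_erase hj)]
      rw [lintegral_indicator_one hV]
    · simp only [X, if_true]
      rw [lintegral_indicator hV]
  rw [← lintegral_indicator hV, lintegral_map (hcA.indicator hV) measurable_iUnion]
  have hsum : ∀ᵐ φ ∂Measure.pi fun _ : ι => μ,
      (void B).indicator (fun ψ : PointConfig E => ψ.countOn A) (iUnion φ)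
        = ∑ i, ∏ j, X i j (φ j) := by
    filter_upwards [ae_pairwise_disjoint_pi (ι := ι) hμ] with φ hφ
    by_cases h : iUnion φ ∈ void B
    · rw [indicator_of_mem h, countOn_iUnion_of_disjoint hφ hA]
      rw [iUnion_mem_void] at h
      refine Finset.sum_congr rfl fun i _ => ?_
      rw [Finset.prod_eq_single i]
      · simp [X, h i]
      · intro j _ hj
        simp [X, hj, h j]
      · simp
    · rw [indicator_of_notMem h]
      rw [iUnion_mem_void, not_forall] at h
      obtain ⟨j, hj⟩ := h
      refine (Finset.sum_eq_zero fun i _ => Finset.prod_eq_zero (Finset.mem_univ j) ?_).symm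
      by_cases hji : j = i
      · simp only [X, if_pos hji, indicator_of_notMem hj]
      · simp only [X, if_neg hji, indicator_of_notMem hj]
  have hm : ∀ i, Measurable fun φ : ι → PointConfig E => ∏ j, X i j (φ j) := fun i =>
    Finset.measurable_fun_prod _ fun j _ => (hX i j).comp (measurable_pi_apply j)
  rw [lintegral_congr_ae hsum, lintegral_finsetSum' _ fun i _ => (hm i).aemeasurable]
  -- For empty `ι` the factor `Fintype.card ι` vanishes, so the truncated exponent is harmless.
  simp only [hprod, Finset.sum_const, Finset.card_univ, nsmul_eq_mul, mul_assoc]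

end Superposition

/-! ### Palm kernels: reduction to void events and uniqueness -/

section Palm

variable {E : Type*} [TopologicalSpace E] [MeasurableSpace E] [T2Space E] [SigmaCompactSpace E]
  [BorelSpace E] [SecondCountableTopology E] {Q : Measure (PointConfig E)}

/-- The Campbell formula need only be checked on void events. -/
theorem isPalmKernel_of_void [IsLocallyFiniteMeasure (intensity Q)] {κ : Kernel E (PointConfig E)}
    [hκ : IsMarkovKernel κ]
    (h : ∀ A : Set E, MeasurableSet A → ∀ B ∈ testSets E,
      ∫⁻ φ in void B, φ.countOn A ∂Q = ∫⁻ x in A, κ x (void B) ∂intensity Q) :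
    IsPalmKernel Q κ := by
  refine ⟨hκ, fun A Y hA hY => ?_⟩
  -- Over a relatively compact `A` both sides are finite measures in `Y`, so agreement on void
  -- events suffices.
  have key : ∀ n, ∫⁻ φ in Y, φ.countOn (A ∩ compactCovering E n) ∂Q
      = ∫⁻ x in A ∩ compactCovering E n, κ x Y ∂intensity Q := by
    intro n
    have hK := isCompact_compactCovering E n
    have hAn := hA.inter hK.measurableSet
    have hfin : intensity Q (A ∩ compactCovering E n) < ∞ :=
      (measure_mono inter_subset_right).trans_lt hK.measure_lt_top
    have h1 : ∀ Z, MeasurableSet Z →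
        Q.withDensity (fun φ => φ.countOn (A ∩ compactCovering E n)) Z
          = ∫⁻ φ in Z, φ.countOn (A ∩ compactCovering E n) ∂Q := fun Z hZ => withDensity_apply _ hZ
    have h2 : ∀ Z, MeasurableSet Z →
        ((intensity Q).restrict (A ∩ compactCovering E n)).bind κ Z
          = ∫⁻ x in A ∩ compactCovering E n, κ x Z ∂intensity Q := fun Z hZ =>
      Measure.bind_apply hZ κ.aemeasurable
    rw [← h1 Y hY, ← h2 Y hY]
    have : IsFiniteMeasure (Q.withDensity (fun φ => φ.countOn (A ∩ compactCovering E n))) := by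
      refine isFiniteMeasure_withDensity ?_
      rw [← intensity_apply Q hAn]
      exact hfin.ne
    congr 1
    refine measure_ext_of_void fun B hB => ?_
    have hV := measurableSet_void (measurableSet_of_mem_testSets hB)
    rw [h1 _ hV, h2 _ hV]
    exact h _ hAn B hB
  have hmono : Monotone fun n => A ∩ compactCovering E n := fun m n h =>
    inter_subset_inter_right _ (compactCovering_subset E h)
  have hU : ⋃ n, A ∩ compactCovering E n = A := by
    rw [← inter_iUnion, iUnion_compactCovering, inter_univ]
  have hmeas : ∀ n, MeasurableSet (A ∩ compactCovering E n) := fun n =>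
    hA.inter (isCompact_compactCovering E n).measurableSet
  have hL : ∫⁻ φ in Y, φ.countOn A ∂Q
      = ⨆ n, ∫⁻ φ in Y, φ.countOn (A ∩ compactCovering E n) ∂Q := by
    rw [← lintegral_iSup (fun n => measurable_countOn_apply (hmeas n))
      (fun m n h φ => measure_mono (hmono h))]
    refine lintegral_congr fun φ => ?_
    rw [← hmono.measure_iUnion, hU]
  have hR : ∫⁻ x in A, κ x Y ∂intensity Q
      = ⨆ n, ∫⁻ x in A ∩ compactCovering E n, κ x Y ∂intensity Q := by
    have h3 : ∀ S, MeasurableSet S → (intensity Q).withDensity (fun x => κ x Y) S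
        = ∫⁻ x in S, κ x Y ∂intensity Q := fun S hS => withDensity_apply _ hS
    simp_rw [← h3 A hA, ← h3 _ (hmeas _)]
    rw [← hmono.measure_iUnion, hU]
  rw [hL, hR]
  exact iSup_congr key

/-- The Palm distributions are unique up to a null set. -/
theorem IsPalmKernel.ae_eq [SigmaFinite (intensity Q)] {κ κ' : Kernel E (PointConfig E)}
    (h : IsPalmKernel Q κ) (h' : IsPalmKernel Q κ') : ∀ᵐ x ∂intensity Q, κ x = κ' x := by
  have := h.isMarkovKernel
  have hall : ∀ᵐ x ∂intensity Q, ∀ Y ∈ voidEvents E, κ x Y = κ' x Y := by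
    rw [ae_ball_iff (countable_voidEvents E)]
    rintro _ ⟨A, hA, rfl⟩
    have hV := measurableSet_void (measurableSet_of_mem_testSets hA)
    refine ae_eq_of_forall_setLIntegral_eq_of_sigmaFinite (κ.measurable_coe hV)
      (κ'.measurable_coe hV) fun S hS _ => ?_
    rw [← h.campbell S _ hS hV, ← h'.campbell S _ hS hV]
  filter_upwards [hall] with x hx
  exact measure_ext_of_void fun A hA => hx _ ⟨A, hA, rfl⟩

end Palm

end PointConfig
-- Law, intensity and Campbell formula of the BLCP
namespace BLCP

open PointConfig

section Laws

variable {Ω : Type*} [MeasurableSpace Ω] {P : Measure Ω} {n : ℕ} {R : ℝ}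
  {rate : ℝ≥0} {τ : Measure (PointConfig ℝ)}

theorem IsPoissonOnLineThrough.aemeasurable (hR : 0 < R) {x : Plane} {Ψ : Ω → PointConfig Plane}
    (hΨ : IsPoissonOnLineThrough P R rate x Ψ) : AEMeasurable Ψ P := by
  obtain ⟨Θ, T, hΘ, hT, -, hΨ⟩ := hΨ
  have hm := hΘ.aemeasurable (volume_directions_ne_zero hR x) (volume_directions_ne_top R x)
  have htp := (measurable_throughPoint.comp (measurable_prodMk_left (x := x))).comp_aemeasurable hm
  refine (measurable_onLine.comp_aemeasurable
    (htp.prodMk hT.measurable.aemeasurable)).congr ?_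
  filter_upwards [hΨ] with ω hω using hω.symm

variable [IsProbabilityMeasure P]

theorem hasLaw_onLine {G : Ω → ℝ × ℝ} {γ : Measure (ℝ × ℝ)} {T : Ω → PointConfig ℝ}
    (hG : HasLaw G γ P) (hT : HasLaw T τ P) (hind : IndepFun G T P) :
    HasLaw (fun ω => onLine (G ω) (T ω)) ((γ.prod τ).map fun p => onLine p.1 p.2) P :=
  (HasLaw.mk measurable_onLine.aemeasurable rfl).comp (hind.hasLaw_prod hG hT)

variable [IsProbabilityMeasure τ]

theorem map_onLine_void {γ : Measure (ℝ × ℝ)} {B : Set Plane} (hB : MeasurableSet B) :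
    (γ.prod τ).map (fun p => onLine p.1 p.2) (void B)
      = ∫⁻ g, τ (void (lineParam g ⁻¹' B)) ∂γ := by
  have hV := measurableSet_void hB
  rw [Measure.map_apply measurable_onLine hV, Measure.prod_apply (measurable_onLine hV)]
  refine lintegral_congr fun g => ?_
  congr 1
  ext T
  exact onLine_mem_void

/-- The law of a BLCP is the law of the union of `n` independent copies of the point process on a
random line. -/
theorem IsBLCP.hasLaw (hR : 0 < R) {Φ : Ω → PointConfig Plane} (hΦ : IsBLCP P n R rate Φ)
    (hτ : ∀ T : Ω → PointConfig ℝ, IsPoissonProcess P rate T → P.map T = τ) :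
    HasLaw Φ ((Measure.pi fun _ : Fin n => lineLaw R τ).map PointConfig.iUnion) P := by
  obtain ⟨G, T, hG, hT, hGT, hind, hΦ⟩ := hΦ
  have := isProbabilityMeasure_lineLaw (τ := τ) hR
  have hline : ∀ i, HasLaw (fun ω => onLine (G i ω) (T i ω)) (lineLaw R τ) P := fun i =>
    hasLaw_onLine ⟨(hG i).aemeasurable (volume_domain_ne_zero hR) (volume_domain_ne_top R), hG i⟩
      ⟨(hT i).measurable.aemeasurable, hτ _ (hT i)⟩ (hGT i)
  have hind' := hind.comp (fun _ p => onLine p.1 p.2) fun _ => measurable_onLine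
  have hpi := hind'.hasLaw_pi hline
  exact ((HasLaw.mk measurable_iUnion.aemeasurable rfl).comp hpi).congr hΦ

theorem IsPoissonOnLineThrough.measure_void (hR : 0 < R) {x : Plane} {Ψ : Ω → PointConfig Plane}
    (hΨ : IsPoissonOnLineThrough P R rate x Ψ)
    (hτ : ∀ T : Ω → PointConfig ℝ, IsPoissonProcess P rate T → P.map T = τ)
    {B : Set Plane} (hB : MeasurableSet B) :
    P (Ψ ⁻¹' void B) = (volume (directions R x))⁻¹ *
      ∫⁻ θ in directions R x, τ (void (lineParam (throughPoint x θ) ⁻¹' B)) := by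
  rw [← Measure.map_apply_of_aemeasurable (hΨ.aemeasurable hR) (measurableSet_void hB)]
  obtain ⟨Θ, T, hΘ, hT, hind, hΨ⟩ := hΨ
  have hm := hΘ.aemeasurable (volume_directions_ne_zero hR x) (volume_directions_ne_top R x)
  have htp : Measurable (throughPoint x) := measurable_throughPoint.comp measurable_prodMk_left
  have hG : HasLaw (fun ω => throughPoint x (Θ ω))
      ((cond volume (directions R x)).map (throughPoint x)) P :=
    (HasLaw.mk htp.aemeasurable rfl).comp (HasLaw.mk hm hΘ)
  have hlaw := (hasLaw_onLine hG ⟨hT.measurable.aemeasurable, hτ T hT⟩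
    (hind.comp htp measurable_id)).congr hΨ
  rw [hlaw.map_eq, map_onLine_void hB, lintegral_map (measurable_void_lineParam hB) htp,
    ProbabilityTheory.cond, lintegral_smul_measure, smul_eq_mul]

variable {A B : Set Plane}

theorem intensity_lineLaw (hR : 0 < R)
    (hτ : ∀ A B : Set ℝ, MeasurableSet A → MeasurableSet B → Disjoint A B →
      ∫⁻ φ in void B, φ.countOn A ∂τ = rate * volume A * τ (void B))
    (hA : MeasurableSet A) :
    intensity (lineLaw R τ) A
      = ∫⁻ x in A, (volume (domain R))⁻¹ * rate * volume (directions R x) := by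
  have h := setLIntegral_void_countOn_lineLaw hR hτ hA MeasurableSet.empty
  simpa [void_empty, ← intensity_apply _ hA] using h

/-- Absolute continuity of the intensity rules out fixed points, which is what makes independent
copies almost surely disjoint. -/
theorem intensity_lineLaw_singleton (hR : 0 < R)
    (hτ : ∀ A B : Set ℝ, MeasurableSet A → MeasurableSet B → Disjoint A B →
      ∫⁻ φ in void B, φ.countOn A ∂τ = rate * volume A * τ (void B)) (x : Plane) :
    intensity (lineLaw R τ) {x} = 0 := by
  rw [intensity_lineLaw hR hτ (measurableSet_singleton x)]
  exact setLIntegral_measure_zero _ _ (measure_singleton x)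

theorem measurable_volume_directions (R : ℝ) : Measurable fun x => volume (directions R x) := by
  simpa using measurable_lintegral_directions R (F := fun _ => 1) measurable_const

theorem measurable_indicator_void_directions (hB : MeasurableSet B) (c : ℝ≥0∞) :
    Measurable (Bᶜ.indicator fun x => c * ((volume (directions R x))⁻¹ *
      ∫⁻ θ in directions R x, τ (void (lineParam (throughPoint x θ) ⁻¹' B)))) := by
  refine Measurable.indicator ?_ hB.compl
  refine ((measurable_volume_directions R).inv.mul ?_).const_mul _
  exact measurable_lintegral_directions R
    (F := fun q => τ (void (lineParam (throughPoint q.1 q.2) ⁻¹' B)))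
    ((measurable_void_lineParam hB).comp measurable_throughPoint)

/-- The Campbell formula of the superposition with `B = ∅`, where all void probabilities equal one.
-/
theorem intensity_blcpLaw (hR : 0 < R)
    (hτ : ∀ A B : Set ℝ, MeasurableSet A → MeasurableSet B → Disjoint A B →
      ∫⁻ φ in void B, φ.countOn A ∂τ = rate * volume A * τ (void B)) :
    intensity ((Measure.pi fun _ : Fin n => lineLaw R τ).map PointConfig.iUnion)
      = volume.withDensity fun x =>
        n * ((volume (domain R))⁻¹ * rate * volume (directions R x)) := by
  have := isProbabilityMeasure_lineLaw (τ := τ) hR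
  ext A hA
  have h := setLIntegral_void_countOn_map_iUnion_pi (ι := Fin n)
    (intensity_lineLaw_singleton hR hτ) hA MeasurableSet.empty
  simp only [void_empty, Measure.restrict_univ, ← intensity_apply _ hA, measure_univ, one_pow,
    mul_one, Fintype.card_fin] at h
  rw [h, intensity_lineLaw hR hτ hA, withDensity_apply _ hA,
    lintegral_const_mul' _ _ (ENNReal.natCast_ne_top n)]

theorem isLocallyFiniteMeasure_intensity_blcpLaw (hR : 0 < R)
    (hτ : ∀ A B : Set ℝ, MeasurableSet A → MeasurableSet B → Disjoint A B →
      ∫⁻ φ in void B, φ.countOn A ∂τ = rate * volume A * τ (void B)) :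
    IsLocallyFiniteMeasure
      (intensity ((Measure.pi fun _ : Fin n => lineLaw R τ).map PointConfig.iUnion)) := by
  have : IsFiniteMeasureOnCompacts
      (intensity ((Measure.pi fun _ : Fin n => lineLaw R τ).map PointConfig.iUnion)) := by
    refine ⟨fun K hK => ?_⟩
    rw [intensity_blcpLaw hR hτ, withDensity_apply _ hK.measurableSet]
    have hc : (n : ℝ≥0∞) * ((volume (domain R))⁻¹ * rate * ENNReal.ofReal Real.pi) ≠ ∞ := by
      refine ENNReal.mul_ne_top (ENNReal.natCast_ne_top n) (ENNReal.mul_ne_top (ENNReal.mul_ne_top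
        (ENNReal.inv_ne_top.mpr (volume_domain_ne_zero hR)) ENNReal.coe_ne_top)
        ENNReal.ofReal_ne_top)
    calc _ ≤ ∫⁻ _ in K, (n : ℝ≥0∞) * ((volume (domain R))⁻¹ * rate * ENNReal.ofReal Real.pi) :=
          lintegral_mono fun x => by gcongr; exact volume_directions_le R x
      _ < ∞ := by
          rw [setLIntegral_const]
          exact ENNReal.mul_lt_top hc.lt_top hK.measure_lt_top
  exact isLocallyFiniteMeasure_of_isFiniteMeasureOnCompacts

/-- The Campbell formula of a BLCP, on void events. -/
theorem setLIntegral_void_countOn_blcpLaw (hR : 0 < R)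
    (hτ : ∀ A B : Set ℝ, MeasurableSet A → MeasurableSet B → Disjoint A B →
      ∫⁻ φ in void B, φ.countOn A ∂τ = rate * volume A * τ (void B))
    (hA : MeasurableSet A) (hB : MeasurableSet B) :
    ∫⁻ φ in void B, φ.countOn A ∂(Measure.pi fun _ : Fin n => lineLaw R τ).map PointConfig.iUnion
      = ∫⁻ x in A, Bᶜ.indicator (fun x => lineLaw R τ (void B) ^ (n - 1) *
          ((volume (directions R x))⁻¹ *
            ∫⁻ θ in directions R x, τ (void (lineParam (throughPoint x θ) ⁻¹' B)))) x
        ∂intensity ((Measure.pi fun _ : Fin n => lineLaw R τ).map PointConfig.iUnion) := by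
  have := isProbabilityMeasure_lineLaw (τ := τ) hR
  have hd := measurable_volume_directions R
  rw [setLIntegral_void_countOn_map_iUnion_pi (intensity_lineLaw_singleton hR hτ) hA hB,
    setLIntegral_void_countOn_lineLaw hR hτ hA hB, intensity_blcpLaw hR hτ,
    setLIntegral_withDensity_eq_setLIntegral_mul _ (by fun_prop)
      (measurable_indicator_void_directions hB _) hA, Fintype.card_fin,
    ← lintegral_const_mul']
  · refine lintegral_congr fun x => ?_
    by_cases hx : x ∈ B
    · simp [hx]
    · simp only [Pi.mul_apply, indicator_of_mem (show x ∈ Bᶜ from hx)]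
      set d := volume (directions R x)
      set I := ∫⁻ θ in directions R x, τ (void (lineParam (throughPoint x θ) ⁻¹' B))
      set q := lineLaw R τ (void B) ^ (n - 1)
      -- The intensity density carries the factor `d` and the uniform direction law carries `d⁻¹`;
      -- they cancel because `0 < d < ∞`.
      have hdd : d * d⁻¹ = 1 := ENNReal.mul_inv_cancel (volume_directions_ne_zero hR x)
        (volume_directions_ne_top R x)
      calc (n : ℝ≥0∞) * q * ((volume (domain R))⁻¹ * rate * I)
          = n * q * ((volume (domain R))⁻¹ * rate * I) * (d * d⁻¹) := by rw [hdd, mul_one]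
        _ = _ := by ring
  · exact ENNReal.mul_ne_top (ENNReal.natCast_ne_top n) (ENNReal.pow_ne_top (measure_ne_top _ _))

end Laws

end BLCP

/-! ### The Palm distributions of the BLCP -/

open PointConfig BLCP in
theorem mainTheorem8 (n : ℕ) (hn : 1 ≤ n) (R : ℝ) (hR : 0 < R) (rate : ℝ≥0) (hrate : 0 < rate)
    {Ω Ω' : Type*} [MeasurableSpace Ω] [MeasurableSpace Ω']
    (P : Measure Ω) [IsProbabilityMeasure P] (P' : Measure Ω') [IsProbabilityMeasure P']
    (Φ : Ω → PointConfig BLCP.Plane) (hΦ : BLCP.IsBLCP P n R rate Φ)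
    (Φ' : Ω' → PointConfig BLCP.Plane) (hΦ' : BLCP.IsBLCP P' (n - 1) R rate Φ')
    (Ψ : BLCP.Plane → Ω' → PointConfig BLCP.Plane)
    (hΨ : ∀ x, BLCP.IsPoissonOnLineThrough P' R rate x (Ψ x))
    (hindep : ∀ x, IndepFun Φ' (Ψ x) P') :
    AEMeasurable Φ P ∧
    IsLocallyFiniteMeasure (PointConfig.intensity (P.map Φ)) ∧
    (∃ κ : Kernel BLCP.Plane (PointConfig BLCP.Plane),
      PointConfig.IsPalmKernel (P.map Φ) κ ∧
      ∀ x, HasLaw (fun ω => Φ' ω ∪ Ψ x ω ∪ {x}) (κ x) P') ∧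
    (∀ κ : Kernel BLCP.Plane (PointConfig BLCP.Plane),
      PointConfig.IsPalmKernel (P.map Φ) κ →
      ∀ᵐ x ∂(PointConfig.intensity (P.map Φ)),
        HasLaw (fun ω => Φ' ω ∪ Ψ x ω ∪ {x}) (κ x) P') := by
  -- As `n ≥ 1`, at least one line carries a Poisson process; its law `τ` is the reference law for
  -- all the others, on `Ω` and on `Ω'`.
  obtain ⟨T, hT⟩ : ∃ T : Ω → PointConfig ℝ, IsPoissonProcess P rate T := by
    obtain ⟨-, T, -, hT, -⟩ := id hΦ
    exact ⟨T ⟨0, hn⟩, hT _⟩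
  set τ := P.map T with hτ_def
  have : IsProbabilityMeasure τ := Measure.isProbabilityMeasure_map hT.measurable.aemeasurable
  have hτ := fun (A B : Set ℝ) => hT.setLIntegral_void_countOn (A := A) (B := B)
  have hτ' : ∀ T' : Ω' → PointConfig ℝ, IsPoissonProcess P' rate T' → P'.map T' = τ :=
    fun T' hT' => hT'.map_eq_map hT
  have := isProbabilityMeasure_lineLaw (τ := τ) hR
  have hlaw := hΦ.hasLaw hR fun T' hT' => (hT'.map_eq_map hT : P.map T' = τ)
  have hlaw' := hΦ'.hasLaw hR hτ'
  have hloc := isLocallyFiniteMeasure_intensity_blcpLaw (n := n) hR hτ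
  have hmeas : ∀ x, AEMeasurable (fun ω => Φ' ω ∪ Ψ x ω ∪ {x}) P' := fun x =>
    measurable_union.comp_aemeasurable ((measurable_union.comp_aemeasurable
      (hlaw'.aemeasurable.prodMk ((hΨ x).aemeasurable hR))).prodMk aemeasurable_const)
  have hvoid : ∀ (x : Plane) (B : Set Plane), MeasurableSet B →
      P'.map (fun ω => Φ' ω ∪ Ψ x ω ∪ {x}) (void B)
        = Bᶜ.indicator (fun x => lineLaw R τ (void B) ^ (n - 1) * ((volume (directions R x))⁻¹ *
          ∫⁻ θ in directions R x, τ (void (lineParam (throughPoint x θ) ⁻¹' B)))) x := by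
    intro x B hB
    have hV := measurableSet_void hB
    rw [Measure.map_apply_of_aemeasurable (hmeas x) hV]
    by_cases hx : x ∈ B
    · have : (fun ω => Φ' ω ∪ Ψ x ω ∪ {x}) ⁻¹' void B = ∅ := by
        ext ω
        simp [union_mem_void, singleton_mem_void, hx]
      simp [this, hx]
    · have : (fun ω => Φ' ω ∪ Ψ x ω ∪ {x}) ⁻¹' void B = Φ' ⁻¹' void B ∩ Ψ x ⁻¹' void B := by
        ext ω
        simp [union_mem_void, singleton_mem_void, hx]
      rw [this, (hindep x).measure_inter_preimage_eq_mul _ _ hV hV,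
        ← Measure.map_apply_of_aemeasurable hlaw'.aemeasurable hV, hlaw'.map_eq,
        map_iUnion_pi_void hB, (hΨ x).measure_void hR hτ' hB, Fintype.card_fin,
        indicator_of_mem (show x ∈ Bᶜ from hx)]
  have hprob : ∀ x, IsProbabilityMeasure (P'.map fun ω => Φ' ω ∪ Ψ x ω ∪ {x}) := fun x =>
    Measure.isProbabilityMeasure_map (hmeas x)
  -- No regularity of `x ↦ Ψ x` is assumed; measurability in `x` comes from the explicit void
  -- probabilities in `hvoid`.
  let κ : Kernel Plane (PointConfig Plane) :=
    { toFun := fun x => P'.map fun ω => Φ' ω ∪ Ψ x ω ∪ {x}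
      measurable' := by
        refine Measurable.measure_of_isPiSystem_of_isProbabilityMeasure
          (generateFrom_voidEvents Plane) (isPiSystem_voidEvents Plane) ?_
        rintro _ ⟨B, hB, rfl⟩
        have hBm := measurableSet_of_mem_testSets hB
        simp_rw [hvoid _ B hBm]
        exact measurable_indicator_void_directions hBm _ }
  have hκ : ∀ x, HasLaw (fun ω => Φ' ω ∪ Ψ x ω ∪ {x}) (κ x) P' := fun x => ⟨hmeas x, rfl⟩
  have : IsMarkovKernel κ := ⟨hprob⟩
  rw [hlaw.map_eq]
  have hpalm : IsPalmKernel ((Measure.pi fun _ : Fin n => lineLaw R τ).map PointConfig.iUnion) κ := by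
    refine isPalmKernel_of_void fun A hA B hB => ?_
    have hBm := measurableSet_of_mem_testSets hB
    rw [setLIntegral_void_countOn_blcpLaw hR hτ hA hBm]
    exact lintegral_congr fun x => (hvoid x B hBm).symm
  refine ⟨hlaw.aemeasurable, hloc, ⟨κ, hpalm, hκ⟩, fun κ' hκ' => ?_⟩
  filter_upwards [hpalm.ae_eq hκ'] with x hx
  rw [← hx]
  exact hκ x
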